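/- Fix $K\ge 1$, path loss factors $\alpha_1,\dots,\alpha_K\ge 0$ and power budgets $\rho_0,\dots,\rho_{K-1}>0$. For every $n\ge 1$ let $n_0=n$ and let $n_k=n_k(n)$, $k=1,\dots,K$, be positive integers such that $c_k=n_{k-1}/n_k$ satisfies $0<\liminf_{n\to\infty} c_k\le\limsup_{n\to\infty} c_k<\infty$ for $k=1,\dots,K$. For every $n$, let $\mathbf H_k\in\mathbb C^{n_k\times n_{k-1}}$ ($k=1,\dots,K$) be random matrices with i.i.d. $\mathcal{CN}(0,1)$ entries, let $\mathbf x\sim\mathcal{CN}(\mathbf 0,\mathbf I_n)$ and $\mathbf n_k\sim\mathcal{CN}(\mathbf 0,\mathbf I_{n_k})$ ($k=1,\dots,K$), with $\mathbf H_1,\dots,\mathbf H_K,\mathbf x,\mathbf n_1,\dots,\mathbf n_K$ mutually independent; all are defined on one probability space, and nothing is assumed about the joint law for different $n$. Define recursively $\mathbf y_0=\mathbf x$ and $$\mathbf y_k=\sqrt{\alpha_k}\,\mathbf H_k\sqrt{\frac{\beta_{k-1}}{n_{k-1}}}\,\mathbf y_{k-1}+\mathbf n_k\quad(k=1,\dots,K),\qquad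 \beta_k=\frac{\rho_k}{\frac1{n_k}\operatorname{tr}\mathbb E\left[\mathbf y_k\mathbf y_k^{\mathsf H}\right]}\quad(k=0,\dots,K-1),$$ where the expectation is with respect to $\mathbf x$ and the noise vectors $\mathbf n_1,\dots,\mathbf n_K$ only, the matrices $\mathbf H_1,\dots,\mathbf H_K$ being held fixed, so that $\beta_k$ is a random variable depending on $\mathbf H_1,\dots,\mathbf H_k$. Then $\beta_0=\rho_0$ for every $n\ge1$, and for every $k=1,\dots,K-1$, almost surely, $$\beta_k\xrightarrow[n\to\infty]{}\bar\beta_k=\frac{\rho_k}{1+\alpha_k\rho_{k-1}}.$$ -/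

import Mathlib

open MeasureTheory ProbabilityTheory Filter Topology
open scoped ENNReal NNReal

noncomputable section

namespace Relay

/-- The standard circularly symmetric complex Gaussian law `CN(0,1)`: independent real and imaginary
parts, each centred Gaussian with variance `1/2`. -/
def stdComplexGaussian : Measure ℂ :=
  ((gaussianReal 0 (1 / 2)).prod (gaussianReal 0 (1 / 2))).map Complex.measurableEquivRealProd.symm

variable {Ω : Type*} [MeasurableSpace Ω]

/-- The matrix `E[y yᴴ]` of a random vector `y`. -/
def secondMoment (P : Measure Ω) {m : ℕ} (y : Ω → Fin m → ℂ) : Matrix (Fin m) (Fin m) ℂ :=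
  Matrix.of fun i j => ∫ ω, Matrix.vecMulVec (y ω) (star (y ω)) i j ∂P

/-- The normalization `r / ((1/m) tr E[y yᴴ])` of a transmitted vector `y` with `m` entries to the
power budget `r`. The trace is a real number, which is read off by `Complex.re`. -/
def powerFactor (P : Measure Ω) (r : ℝ) {m : ℕ} (y : Ω → Fin m → ℂ) : ℝ :=
  r / ((1 / (m : ℝ)) * (secondMoment P y).trace.re)

/-- For *fixed* channel matrices `h`, the pair consisting of the vector that node `k` retransmits and
its power normalization factor. Node `0` is the source, with vector `x`; for `k ≥ 1` the vector
is the received signal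
`y_k = √α_k H_k √(β_{k-1} / n_{k-1}) y_{k-1} + w_k` (with `y_0 = x`).
Node `k` has `d k` antennas, `h k` is the channel matrix `H_{k+1}` from node `k` to node `k + 1`,
and `w k` is the noise vector `w_{k+1}` at node `k + 1`. Since `h` is fixed, the expectations in the
normalization factors are over `x` and `w` only. -/
def node (P : Measure Ω) (α ρ : ℕ → ℝ) (d : ℕ → ℕ)
    (h : ∀ k, Matrix (Fin (d (k + 1))) (Fin (d k)) ℂ)
    (x : Ω → Fin (d 0) → ℂ) (w : ∀ k, Ω → Fin (d (k + 1)) → ℂ) :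
    ∀ k : ℕ, (Ω → Fin (d k) → ℂ) × ℝ
  | 0 => (x, powerFactor P (ρ 0) x)
  | k + 1 =>
    let y : Ω → Fin (d k) → ℂ := (node P α ρ d h x w k).1
    let β : ℝ := (node P α ρ d h x w k).2
    let y' : Ω → Fin (d (k + 1)) → ℂ := fun ω =>
      (√(α (k + 1)) : ℂ) • (h k).mulVec ((√(β / d k) : ℂ) • y ω) + w k ω
    (y', powerFactor P (ρ (k + 1)) y')

/-- The random power normalization factor `β_k`: a function of the realization `H(ω)` of the channel
matrices, the expectation being taken over the transmit vector and the noise vectors only. -/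
def beta (P : Measure Ω) (α ρ : ℕ → ℝ) (d : ℕ → ℕ)
    (H : ∀ k, Ω → Matrix (Fin (d (k + 1))) (Fin (d k)) ℂ)
    (x : Ω → Fin (d 0) → ℂ) (w : ∀ k, Ω → Fin (d (k + 1)) → ℂ) (k : ℕ) (ω : Ω) : ℝ :=
  (node P α ρ d (fun j => H j ω) x w k).2

/-- The positions of all scalar entries of `H_1, …, H_K`, of `x`, and of `w_1, …, w_K`. -/
abbrev EntryIndex (K : ℕ) (d : ℕ → ℕ) : Type :=
  (Σ k : Fin K, Fin (d (k + 1)) × Fin (d k)) ⊕ Fin (d 0) ⊕ (Σ k : Fin K, Fin (d (k + 1)))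

/-- The family of all scalar entries of `H_1, …, H_K`, of `x`, and of `w_1, …, w_K`. -/
def entry (K : ℕ) (d : ℕ → ℕ)
    (H : ∀ k, Ω → Matrix (Fin (d (k + 1))) (Fin (d k)) ℂ)
    (x : Ω → Fin (d 0) → ℂ) (w : ∀ k, Ω → Fin (d (k + 1)) → ℂ) :
    EntryIndex K d → Ω → ℂ
  | .inl ⟨k, i, j⟩ => fun ω => H k ω i j
  | .inr (.inl i) => fun ω => x ω i
  | .inr (.inr ⟨k, i⟩) => fun ω => w k ω i

/-- The randomness of the `K`-hop relay model at one system size: the matrices `H_1, …, H_K` are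
standard complex Gaussian, `x` and the noise vectors `w_1, …, w_K` are `CN(0, I)`, and all of these
are mutually independent. -/
structure IsGaussianModel (P : Measure Ω) (K : ℕ) (d : ℕ → ℕ)
    (H : ∀ k, Ω → Matrix (Fin (d (k + 1))) (Fin (d k)) ℂ)
    (x : Ω → Fin (d 0) → ℂ) (w : ∀ k, Ω → Fin (d (k + 1)) → ℂ) : Prop where
  law : ∀ e, HasLaw (entry K d H x w e) stdComplexGaussian P
  indep : iIndepFun (entry K d H x w) P

end Relay

end

/-
For fixed channels the second moments of the `y_k` obey a recursion, so that
`β_{k+1} = ρ_{k+1} / (1 + α_{k+1} ρ_k g_k)`, where `g_k = tr (H q Hᴴ) / (n_{k+1} tr q)` for the next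
channel matrix `H` and the covariance `q` of `y_k`. Given the earlier channels, `g_k` is the average
of `n_{k+1}` independent, normalized Hermitian forms in the rows of `H`, each of mean `1`. A sum of
squares decomposition of `q` and Jensen's inequality bound their moments by those of a single
Gaussian, uniformly in `q`, so `E |g_k - 1|⁴ = O(1 / n_{k+1}²)`. The dimensions grow at least
linearly in `n`, hence these bounds are summable and `g_k → 1` almost surely, whatever the joint
law for different `n`.
-/

noncomputable section

namespace Relay

section Gaussian

instance : IsProbabilityMeasure stdComplexGaussian :=
  Measure.isProbabilityMeasure_map (MeasurableEquiv.measurable _).aemeasurable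

lemma hasLaw_re : HasLaw Complex.re (gaussianReal 0 (1 / 2)) stdComplexGaussian where
  aemeasurable := by fun_prop
  map_eq := by
    rw [stdComplexGaussian, Measure.map_map (by fun_prop) (by fun_prop)]
    exact measurePreserving_fst.map_eq

lemma hasLaw_im : HasLaw Complex.im (gaussianReal 0 (1 / 2)) stdComplexGaussian where
  aemeasurable := by fun_prop
  map_eq := by
    rw [stdComplexGaussian, Measure.map_map (by fun_prop) (by fun_prop)]
    exact measurePreserving_snd.map_eq

lemma memLp_id_stdComplexGaussian {p : ℝ≥0∞} (hp : p ≠ ∞) : MemLp id p stdComplexGaussian := by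
  have memLp_of_hasLaw {f : ℂ → ℝ} (hf : HasLaw f (gaussianReal 0 (1 / 2)) stdComplexGaussian) :
      MemLp f p stdComplexGaussian := by
    have h := memLp_id_gaussianReal' (μ := 0) (v := 1 / 2) p hp
    rw [← hf.map_eq] at h
    exact h.comp_of_map hf.aemeasurable
  exact memLp_re_im_iff.1 ⟨memLp_of_hasLaw hasLaw_re, memLp_of_hasLaw hasLaw_im⟩

lemma integral_id_stdComplexGaussian : ∫ z, z ∂stdComplexGaussian = 0 := by
  have hi : Integrable (fun z : ℂ => z) stdComplexGaussian :=
    (memLp_id_stdComplexGaussian (p := 1) (by simp)).integrable le_rfl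
  apply Complex.ext
  · exact (integral_re hi).symm.trans (hasLaw_re.integral_eq.trans integral_id_gaussianReal)
  · exact (integral_im hi).symm.trans (hasLaw_im.integral_eq.trans integral_id_gaussianReal)

lemma integral_norm_sq_stdComplexGaussian : ∫ z, ‖z‖ ^ 2 ∂stdComplexGaussian = 1 := by
  have integral_sq {f : ℂ → ℝ} (hf : HasLaw f (gaussianReal 0 (1 / 2)) stdComplexGaussian) :
      ∫ z, f z ^ 2 ∂stdComplexGaussian = 1 / 2 := by
    have hvar := hf.variance_eq.trans variance_id_gaussianReal
    have hmean : ∫ z, f z ∂stdComplexGaussian = 0 := hf.integral_eq.trans integral_id_gaussianReal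
    rw [variance_of_integral_eq_zero hf.aemeasurable hmean] at hvar
    simpa using hvar
  obtain ⟨hre, him⟩ :
      MemLp Complex.re 2 stdComplexGaussian ∧ MemLp Complex.im 2 stdComplexGaussian :=
    memLp_re_im_iff.2 (memLp_id_stdComplexGaussian (by simp))
  calc ∫ z, ‖z‖ ^ 2 ∂stdComplexGaussian
      = ∫ z : ℂ, z.re ^ 2 + z.im ^ 2 ∂stdComplexGaussian := by
        simp_rw [← Complex.normSq_eq_norm_sq, Complex.normSq_apply, ← sq]
    _ = 1 := by
        rw [integral_add hre.integrable_sq him.integrable_sq, integral_sq hasLaw_re,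
          integral_sq hasLaw_im]
        norm_num

lemma charFun_stdComplexGaussian (t : ℂ) :
    charFun stdComplexGaussian t = Complex.exp (-(‖t‖ ^ 2 / 4 : ℝ)) := by
  have hfactor (p : ℝ × ℝ) :
      Complex.exp (inner ℝ (Complex.measurableEquivRealProd.symm p) t * Complex.I) =
        Complex.exp (t.re * p.1 * Complex.I) * Complex.exp (t.im * p.2 * Complex.I) := by
    rw [← Complex.exp_add, Complex.inner]
    simp [Complex.measurableEquivRealProd]
    ring_nf
  rw [charFun_apply, stdComplexGaussian, integral_map_equiv]
  simp_rw [hfactor]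
  rw [integral_prod_mul (fun a : ℝ => Complex.exp (t.re * a * Complex.I))
    (fun b : ℝ => Complex.exp (t.im * b * Complex.I)), ← charFun_apply_real, ← charFun_apply_real,
    charFun_gaussianReal, charFun_gaussianReal, ← Complex.exp_add, ← Complex.normSq_eq_norm_sq,
    Complex.normSq_apply]
  congr 1
  push_cast
  ring

variable {Ω ι : Type*} [MeasurableSpace Ω] {P : Measure Ω}

lemma memLp_of_hasLaw {X : Ω → ℂ} (hX : HasLaw X stdComplexGaussian P) {p : ℝ≥0∞} (hp : p ≠ ∞) :
    MemLp X p P := by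
  have h := memLp_id_stdComplexGaussian hp
  rw [← hX.map_eq] at h
  exact h.comp_of_map hX.aemeasurable

lemma charFun_map_const_mul {X : Ω → ℂ} (hX : HasLaw X stdComplexGaussian P) (b t : ℂ) :
    charFun (P.map fun ω => b * X ω) t = Complex.exp (-(‖b‖ ^ 2 * ‖t‖ ^ 2 / 4 : ℝ)) := by
  have hinner (z : ℂ) : inner ℝ (b * z) t = inner ℝ z (star b * t) := by
    simp only [Complex.inner, map_mul, Complex.star_def]
    ring_nf
  rw [← mul_pow, ← norm_star b, ← norm_mul, ← charFun_stdComplexGaussian, charFun_apply,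
    charFun_apply, integral_map (by fun_prop) (by fun_prop), ← hX.integral_comp (by fun_prop)]
  simp [hinner]

variable [Fintype ι] {X : ι → Ω → ℂ}

lemma memLp_sum_mul (hX : ∀ i, HasLaw (X i) stdComplexGaussian P) (b : ι → ℂ) {p : ℝ≥0∞}
    (hp : p ≠ ∞) : MemLp (fun ω => ∑ i, b i * X i ω) p P :=
  memLp_finsetSum _ fun i _ => (memLp_of_hasLaw (hX i) hp).const_mul (b i)

lemma hasLaw_sum_mul (hX : ∀ i, HasLaw (X i) stdComplexGaussian P) (hind : iIndepFun X P)
    (b : ι → ℂ) :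
    HasLaw (fun ω => ∑ i, b i * X i ω)
      (stdComplexGaussian.map fun z => (√(∑ i, ‖b i‖ ^ 2) : ℂ) * z) P where
  aemeasurable := by fun_prop
  map_eq := by
    have := hind.isProbabilityMeasure
    refine Measure.ext_of_charFun (funext fun t => ?_)
    have hind' : iIndepFun (fun i ω => b i * X i ω) P :=
      hind.comp (fun i z => b i * z) fun i => by fun_prop
    rw [hind'.charFun_map_fun_sum_eq_prod (by fun_prop), Finset.prod_apply,
      charFun_map_const_mul (X := fun z => z) HasLaw.id]
    simp_rw [fun i => charFun_map_const_mul (hX i)]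
    rw [← Complex.exp_sum, Complex.norm_real, Real.norm_eq_abs, sq_abs,
      Real.sq_sqrt (by positivity)]
    push_cast
    simp [Finset.sum_mul, Finset.sum_div]

lemma integral_norm_sum_mul_pow (hX : ∀ i, HasLaw (X i) stdComplexGaussian P)
    (hind : iIndepFun X P) (b : ι → ℂ) (n : ℕ) :
    ∫ ω, ‖∑ i, b i * X i ω‖ ^ (2 * n) ∂P =
      (∑ i, ‖b i‖ ^ 2) ^ n * ∫ z, ‖z‖ ^ (2 * n) ∂stdComplexGaussian := by
  refine ((hasLaw_sum_mul hX hind b).integral_comp (f := fun z => ‖z‖ ^ (2 * n))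
    (by fun_prop)).trans ?_
  rw [integral_map (by fun_prop) (by fun_prop)]
  simp_rw [norm_mul, Complex.norm_real, Real.norm_eq_abs, mul_pow, pow_mul, sq_abs]
  rw [integral_const_mul, Real.sq_sqrt (by positivity)]

end Gaussian

section QuadraticForm

open scoped ComplexOrder

variable {ι κ : Type*} [Fintype ι] [Fintype κ]

/-- The Hermitian form `z q zᴴ` of a row vector `z`. For the rows `z` of a channel matrix `h` it
gives the diagonal entries of the covariance `h q hᴴ` of the received signal. -/
def quadForm (q : Matrix ι ι ℂ) (z : ι → ℂ) : ℝ :=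
  (z ⬝ᵥ q.mulVec (star z)).re

lemma measurable_quadForm :
    Measurable fun p : (ι → ι → ℂ) × (ι → ℂ) => quadForm (Matrix.of p.1) p.2 := by
  simp only [quadForm, dotProduct, Matrix.mulVec, Matrix.of_apply, Pi.star_apply]
  fun_prop

lemma quadForm_nonneg {q : Matrix ι ι ℂ} (hq : q.PosSemidef) (z : ι → ℂ) : 0 ≤ quadForm q z := by
  simpa [quadForm] using hq.re_dotProduct_nonneg (star z)

lemma trace_mul_mul_conjTranspose_re (q : Matrix ι ι ℂ) (h : Matrix κ ι ℂ) :
    (h * q * h.conjTranspose).trace.re = ∑ i, quadForm q (h i) := by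
  rw [Matrix.mul_assoc, Matrix.trace, Complex.re_sum]
  rfl

lemma quadForm_sum_vecMulVec (v : κ → ι → ℂ) (z : ι → ℂ) :
    quadForm (∑ l, Matrix.vecMulVec (v l) (star (v l))) z = ∑ l, ‖∑ i, v l i * z i‖ ^ 2 := by
  simp only [quadForm, Matrix.sum_mulVec, dotProduct_sum, Complex.re_sum]
  refine Finset.sum_congr rfl fun l _ => ?_
  rw [Matrix.vecMulVec_mulVec, dotProduct_smul, Matrix.star_dotProduct_star, dotProduct_comm,
    op_smul_eq_mul, ← starRingEnd_apply, Complex.mul_conj, Complex.ofReal_re, ← Complex.sq_norm]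
  rfl

lemma trace_re_sum_vecMulVec (v : κ → ι → ℂ) :
    (∑ l, Matrix.vecMulVec (v l) (star (v l))).trace.re = ∑ l, ∑ i, ‖v l i‖ ^ 2 := by
  simp [Matrix.trace_sum, Matrix.trace_vecMulVec, dotProduct, ← Complex.normSq_eq_norm_sq,
    Complex.normSq_apply]

variable {Ω : Type*} [MeasurableSpace Ω] {P : Measure Ω} {X : ι → Ω → ℂ} {q : Matrix ι ι ℂ}

lemma memLp_quadForm (hX : ∀ i, HasLaw (X i) stdComplexGaussian P) (hq : q.PosSemidef)
    {p : ℝ≥0∞} (hp : p ≠ ∞) : MemLp (fun ω => quadForm q fun i => X i ω) p P := by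
  obtain ⟨m, v, rfl⟩ := Matrix.posSemidef_iff_eq_sum_vecMulVec.1 hq
  simp_rw [quadForm_sum_vecMulVec]
  refine memLp_finsetSum _ fun l _ => ?_
  have h2p : p * 2 ≠ ∞ := ENNReal.mul_ne_top hp (by simp)
  simpa [ENNReal.mul_div_cancel_right] using (memLp_sum_mul hX (v l) h2p).norm_rpow_div 2

lemma integral_quadForm (hX : ∀ i, HasLaw (X i) stdComplexGaussian P) (hind : iIndepFun X P)
    (hq : q.PosSemidef) : ∫ ω, quadForm q (fun i => X i ω) ∂P = q.trace.re := by
  obtain ⟨m, v, rfl⟩ := Matrix.posSemidef_iff_eq_sum_vecMulVec.1 hq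
  simp_rw [quadForm_sum_vecMulVec, trace_re_sum_vecMulVec]
  rw [integral_finsetSum _ fun l _ =>
    (memLp_sum_mul hX (v l) (by simp)).integrable_norm_pow two_ne_zero]
  refine Finset.sum_congr rfl fun l _ => ?_
  simpa [integral_norm_sq_stdComplexGaussian] using integral_norm_sum_mul_pow hX hind (v l) 1

lemma sum_div_sum_pow_le {a s : κ → ℝ} (ha : ∀ l, 0 ≤ a l) (hs : ∀ l, 0 ≤ s l)
    (hsa : ∀ l, s l = 0 → a l = 0) (hpos : 0 < ∑ l, s l) (n : ℕ) :
    ((∑ l, a l) / ∑ l, s l) ^ n ≤ ∑ l, s l / (∑ l, s l) * (a l / s l) ^ n := by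
  have hfactor : (∑ l, a l) / ∑ l, s l = ∑ l, s l / (∑ l, s l) * (a l / s l) := by
    rw [Finset.sum_div]
    refine Finset.sum_congr rfl fun l _ => ?_
    rw [div_mul_eq_mul_div, mul_div_cancel_of_imp' (hsa l)]
  rw [hfactor]
  refine Real.pow_arith_mean_le_arith_mean_pow _ _ _ (fun l _ => div_nonneg (hs l) hpos.le) ?_
    (fun l _ => div_nonneg (ha l) (hs l)) n
  rw [← Finset.sum_div, div_self hpos.ne']

lemma integral_quadForm_div_trace_pow_le (hX : ∀ i, HasLaw (X i) stdComplexGaussian P)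
    (hind : iIndepFun X P) (hq : q.PosSemidef) (ht : 0 < q.trace.re) (n : ℕ) :
    ∫ ω, (quadForm q (fun i => X i ω) / q.trace.re) ^ n ∂P ≤
      ∫ z, ‖z‖ ^ (2 * n) ∂stdComplexGaussian := by
  have := hind.isProbabilityMeasure
  obtain ⟨m, v, rfl⟩ := Matrix.posSemidef_iff_eq_sum_vecMulVec.1 hq
  simp_rw [quadForm_sum_vecMulVec]
  rw [trace_re_sum_vecMulVec] at ht ⊢
  set s : Fin m → ℝ := fun l => ∑ i, ‖v l i‖ ^ 2 with hs
  set Y : Fin m → Ω → ℂ := fun l ω => ∑ i, v l i * X i ω with hY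
  have hs0 l : 0 ≤ s l := by positivity
  have hYs l ω (hl : s l = 0) : Y l ω = 0 := by
    have hv : v l = 0 := by simpa [hs, Finset.sum_eq_zero_iff_of_nonneg, funext_iff] using hl
    simp [hY, hv]
  have hint l : Integrable (fun ω => ‖Y l ω‖ ^ (2 * n)) P :=
    (memLp_sum_mul hX (v l) (ENNReal.natCast_ne_top _)).integrable_norm_pow'
  calc ∫ ω, ((∑ l, ‖Y l ω‖ ^ 2) / ∑ l, s l) ^ n ∂P
      ≤ ∫ ω, ∑ l, s l / (∑ l, s l) * (‖Y l ω‖ ^ (2 * n) / s l ^ n) ∂P := by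
        refine integral_mono_of_nonneg (ae_of_all _ fun ω => by positivity)
          (integrable_finsetSum _ fun l _ => ((hint l).div_const _).const_mul _)
          (ae_of_all _ fun ω => ?_)
        simp only [pow_mul, ← div_pow]
        exact sum_div_sum_pow_le (fun l => by positivity) hs0
          (fun l hl => by simp [hYs l ω hl]) ht n
    _ = ∑ l, s l / (∑ l, s l) * ((s l ^ n * ∫ z, ‖z‖ ^ (2 * n) ∂stdComplexGaussian) / s l ^ n) := by
        rw [integral_finsetSum _ fun l _ => ((hint l).div_const _).const_mul _]
        simp only [integral_const_mul, integral_div, hY, integral_norm_sum_mul_pow hX hind]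
        rfl
    _ ≤ ∑ l, s l / (∑ l, s l) * ∫ z, ‖z‖ ^ (2 * n) ∂stdComplexGaussian := by
        gcongr with l
        rw [mul_div_right_comm]
        exact mul_le_of_le_one_left (by positivity) (div_self_le_one _)
    _ = ∫ z, ‖z‖ ^ (2 * n) ∂stdComplexGaussian := by
        rw [← Finset.sum_mul, ← Finset.sum_div, div_self ht.ne', one_mul]

end QuadraticForm

section FourthMoment

variable {Ω ι : Type*} [MeasurableSpace Ω] {P : Measure Ω}

lemma integrable_pow_of_memLp [IsFiniteMeasure P] {f : Ω → ℝ} {p : ℝ≥0∞} (hf : MemLp f p P)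
    {a : ℕ} (ha : a ≤ p) : Integrable (fun ω => f ω ^ a) P :=
  (integrable_norm_iff (hf.1.pow a)).1 (by simpa using (hf.mono_exponent ha).integrable_norm_pow')

lemma integral_add_pow_four [IsProbabilityMeasure P] {U V : Ω → ℝ} (hU : MemLp U 4 P)
    (hV : MemLp V 4 P) (hUV : IndepFun U V P) (hU0 : ∫ ω, U ω ∂P = 0) (hV0 : ∫ ω, V ω ∂P = 0) :
    ∫ ω, (U ω + V ω) ^ 4 ∂P =
      ∫ ω, U ω ^ 4 ∂P + 6 * ((∫ ω, U ω ^ 2 ∂P) * ∫ ω, V ω ^ 2 ∂P) + ∫ ω, V ω ^ 4 ∂P := by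
  have hind (a b : ℕ) : IndepFun (fun ω => U ω ^ a) (fun ω => V ω ^ b) P :=
    hUV.comp (measurable_id.pow_const a) (measurable_id.pow_const b)
  have hint (a : ℕ) (ha : a ∈ Finset.range 5) : Integrable (fun ω => U ω ^ a * V ω ^ (4 - a)) P :=
    (hind a (4 - a)).integrable_mul
      (integrable_pow_of_memLp hU (by exact_mod_cast Finset.mem_range_succ_iff.1 ha))
      (integrable_pow_of_memLp hV (by exact_mod_cast Nat.sub_le 4 a))
  have hmul (a b : ℕ) : ∫ ω, U ω ^ a * V ω ^ b ∂P = (∫ ω, U ω ^ a ∂P) * ∫ ω, V ω ^ b ∂P :=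
    (hind a b).integral_fun_mul_eq_mul_integral (hU.1.pow a) (hV.1.pow b)
  simp_rw [add_pow]
  rw [integral_finsetSum _ fun a ha => (hint a ha).mul_const _]
  simp [integral_mul_const, hmul, Finset.sum_range_succ, hU0, hV0, Nat.choose]
  ring

lemma sq_integral_sq_le [IsProbabilityMeasure P] {f : Ω → ℝ} (hf : MemLp f 4 P) :
    (∫ ω, f ω ^ 2 ∂P) ^ 2 ≤ ∫ ω, f ω ^ 4 ∂P := by
  have hsq : MemLp (fun ω => f ω ^ 2) 2 P := by
    refine (memLp_two_iff_integrable_sq (hf.1.pow 2)).2 ?_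
    simpa [← pow_mul] using integrable_pow_of_memLp hf (a := 4) (by simp)
  have h := variance_nonneg (fun ω => f ω ^ 2) P
  rw [variance_eq_sub hsq] at h
  simpa [← pow_mul] using h

lemma integral_sum_sq {Z : ι → Ω → ℝ} (hZ : ∀ i, MemLp (Z i) 2 P) (hind : iIndepFun Z P)
    (h0 : ∀ i, ∫ ω, Z i ω ∂P = 0) (s : Finset ι) :
    ∫ ω, (∑ i ∈ s, Z i ω) ^ 2 ∂P = ∑ i ∈ s, ∫ ω, Z i ω ^ 2 ∂P := by
  have := hind.isProbabilityMeasure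
  have h := IndepFun.variance_sum (s := s) (fun i _ => hZ i) fun i _ j _ hij => hind.indepFun hij
  have hsum : ∫ ω, (∑ i ∈ s, Z i) ω ∂P = 0 := by
    simp_rw [Finset.sum_apply]
    rw [integral_finsetSum _ fun i _ => (hZ i).integrable one_le_two]
    simp [h0]
  rw [variance_of_integral_eq_zero (memLp_finsetSum' s fun i _ => hZ i).1.aemeasurable hsum] at h
  simpa [variance_of_integral_eq_zero (hZ _).1.aemeasurable (h0 _)] using h

lemma integral_sum_pow_four_le {Z : ι → Ω → ℝ} (hZ : ∀ i, MemLp (Z i) 4 P) (hind : iIndepFun Z P)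
    (h0 : ∀ i, ∫ ω, Z i ω ∂P = 0) {C : ℝ} (hC : ∀ i, ∫ ω, Z i ω ^ 4 ∂P ≤ C) (s : Finset ι) :
    ∫ ω, (∑ i ∈ s, Z i ω) ^ 4 ∂P ≤ 3 * C * (s.card : ℝ) ^ 2 := by
  classical
  have := hind.isProbabilityMeasure
  have hZ2 i : ∫ ω, Z i ω ^ 2 ∂P ≤ √C :=
    Real.le_sqrt_of_sq_le ((sq_integral_sq_le (hZ i)).trans (hC i))
  induction s using Finset.induction_on with
  | empty => simp
  | insert i s hi ih =>
    have hC0 : 0 ≤ C := (integral_nonneg fun ω => by positivity).trans (hC i)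
    have hindep : IndepFun (Z i) (fun ω => ∑ j ∈ s, Z j ω) P := by
      have h := hind.indepFun_finsetSum_of_notMem₀ (fun j => (hZ j).1.aemeasurable) hi
      simpa [Finset.sum_fn] using h.symm
    have hsum0 : ∫ ω, ∑ j ∈ s, Z j ω ∂P = 0 := by
      rw [integral_finsetSum _ fun j _ => (hZ j).integrable (by simp)]
      simp [h0]
    have hsum2 : ∫ ω, (∑ j ∈ s, Z j ω) ^ 2 ∂P ≤ s.card * √C := by
      rw [integral_sum_sq (fun j => (hZ j).mono_exponent (by norm_num)) hind h0, ← nsmul_eq_mul]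
      exact Finset.sum_le_card_nsmul _ _ _ fun j _ => hZ2 j
    simp only [Finset.sum_insert hi, Finset.card_insert_of_notMem hi]
    rw [integral_add_pow_four (hZ i) (memLp_finsetSum s fun j _ => hZ j) hindep (h0 i) hsum0]
    calc _ ≤ C + 6 * (√C * (s.card * √C)) + 3 * C * (s.card : ℝ) ^ 2 := by
          gcongr
          exacts [hC i, hZ2 i]
      _ = C * (1 + 6 * s.card + 3 * (s.card : ℝ) ^ 2) := by
          linear_combination 6 * s.card * Real.mul_self_sqrt hC0
      _ ≤ C * (3 * (s.card + 1) ^ 2) := by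
          gcongr
          linarith
      _ = 3 * C * ((s.card + 1 : ℕ) : ℝ) ^ 2 := by
          push_cast
          ring

end FourthMoment

section Independence

variable {Ω : Type*} [MeasurableSpace Ω] {P : Measure Ω}

lemma iIndepFun_curry {ι κ E : Type*} [Countable ι] [Countable κ] [MeasurableSpace E]
    {X : κ × ι → Ω → E} (hX : ∀ p, AEMeasurable (X p) P) (hind : iIndepFun X P) :
    iIndepFun (fun k ω i => X (k, i) ω) P := by
  have := hind.isProbabilityMeasure
  have hmap p := Measure.isProbabilityMeasure_map (hX p)
  have hrow k : P.map (fun ω i => X (k, i) ω) = .infinitePi fun i => P.map (X (k, i)) :=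
    (iIndepFun_iff_map_fun_eq_infinitePi_map₀' fun i => hX (k, i)).1
      (hind.precomp (Prod.mk_right_injective k))
  have hrow_meas k : AEMeasurable (fun ω i => X (k, i) ω) P := by fun_prop
  rw [iIndepFun_iff_map_fun_eq_infinitePi_map₀' hrow_meas]
  simp_rw [hrow]
  rw [← Measure.infinitePi_map_curry fun k i => P.map (X (k, i)),
    ← (iIndepFun_iff_map_fun_eq_infinitePi_map₀' hX).1 hind,
    AEMeasurable.map_map_of_aemeasurable (by fun_prop) (by fun_prop)]
  rfl

lemma indepFun_precomp_of_disjoint_range {ι σ τ E : Type*} [Finite σ] [Finite τ]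
    [MeasurableSpace E] {X : ι → Ω → E} (hX : ∀ i, AEMeasurable (X i) P) (hind : iIndepFun X P)
    {f : σ → ι} {g : τ → ι} (hfg : Disjoint (Set.range f) (Set.range g)) :
    IndepFun (fun ω s => X (f s) ω) (fun ω t => X (g t) ω) P := by
  have h := hind.indepFun_finset₀ (Set.finite_range f).toFinset (Set.finite_range g).toFinset
    (by simpa using hfg) hX
  exact h.comp (φ := fun u s => u ⟨f s, by simp⟩) (ψ := fun u t => u ⟨g t, by simp⟩)
    (measurable_pi_lambda _ fun _ => measurable_pi_apply _)
    (measurable_pi_lambda _ fun _ => measurable_pi_apply _)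

lemma lintegral_le_of_indepFun {E F : Type*} [MeasurableSpace E] [MeasurableSpace F]
    [IsProbabilityMeasure P] {X : Ω → E} {Y : Ω → F} (hX : AEMeasurable X P)
    (hY : AEMeasurable Y P) (hXY : IndepFun X Y P) {f : E → F → ℝ≥0∞}
    (hf : Measurable (Function.uncurry f)) {C : ℝ≥0∞}
    (h : ∀ ω, ∫⁻ ω', f (X ω) (Y ω') ∂P ≤ C) : ∫⁻ ω, f (X ω) (Y ω) ∂P ≤ C := by
  have := Measure.isProbabilityMeasure_map hY
  calc ∫⁻ ω, f (X ω) (Y ω) ∂P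
      = ∫⁻ p, Function.uncurry f p ∂(P.map fun ω => (X ω, Y ω)) :=
        (lintegral_map' hf.aemeasurable (hX.prodMk hY)).symm
    _ = ∫⁻ a, ∫⁻ b, f a b ∂P.map Y ∂P.map X := by
        rw [hXY.map_prod_eq_prod_map_map hX hY, lintegral_prod _ hf.aemeasurable]
        rfl
    _ = ∫⁻ ω, ∫⁻ ω', f (X ω) (Y ω') ∂P ∂P := by
        rw [lintegral_map' hf.lintegral_prod_right.aemeasurable hX]
        congr with ω
        exact lintegral_map' (hf.comp measurable_prodMk_left).aemeasurable hY
    _ ≤ ∫⁻ _, C ∂P := lintegral_mono h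
    _ = C := by simp

end Independence

section Gain

open scoped ComplexOrder

variable {ι κ : Type*} [Fintype ι] [Fintype κ]

/-- The normalized power gain `tr (h q hᴴ) / (m tr q)` of a channel matrix `h` with `m` rows, whose
input has covariance `q`. -/
def gain (q : Matrix ι ι ℂ) (h : Matrix κ ι ℂ) : ℝ :=
  (h * q * h.conjTranspose).trace.re / (Fintype.card κ * q.trace.re)

lemma gain_eq_sum (q : Matrix ι ι ℂ) (h : Matrix κ ι ℂ) :
    gain q h = (∑ i, quadForm q (h i) / q.trace.re) / Fintype.card κ := by
  rw [gain, trace_mul_mul_conjTranspose_re, mul_comm, ← div_div, Finset.sum_div]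

lemma gain_sub_one [Nonempty κ] (q : Matrix ι ι ℂ) (h : Matrix κ ι ℂ) :
    gain q h - 1 = (∑ i, (quadForm q (h i) / q.trace.re - 1)) / Fintype.card κ := by
  have : (Fintype.card κ : ℝ) ≠ 0 := Nat.cast_ne_zero.2 Fintype.card_ne_zero
  rw [gain_eq_sum]
  simp [sub_div, this]

lemma measurable_gain :
    Measurable fun p : (ι → ι → ℂ) × (κ → ι → ℂ) => gain (Matrix.of p.1) (Matrix.of p.2) := by
  have hquad i : Measurable fun p : (ι → ι → ℂ) × (κ → ι → ℂ) =>
      quadForm (Matrix.of p.1) (p.2 i) :=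
    measurable_quadForm.comp (f := fun p : (ι → ι → ℂ) × (κ → ι → ℂ) => (p.1, p.2 i))
      (by fun_prop)
  simp only [gain_eq_sum, Matrix.trace, Matrix.diag_apply, Matrix.of_apply]
  fun_prop

variable {Ω : Type*} [MeasurableSpace Ω] {P : Measure Ω} {q : Matrix ι ι ℂ}

lemma memLp_quadForm_div_trace {X : ι → Ω → ℂ} (hX : ∀ i, HasLaw (X i) stdComplexGaussian P)
    (hq : q.PosSemidef) {p : ℝ≥0∞} (hp : p ≠ ∞) :
    MemLp (fun ω => quadForm q (fun i => X i ω) / q.trace.re) p P := by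
  simpa only [div_eq_mul_inv] using (memLp_quadForm hX hq hp).mul_const (q.trace.re)⁻¹

lemma integral_quadForm_div_trace_sub_one_pow_four_le {X : ι → Ω → ℂ}
    (hX : ∀ i, HasLaw (X i) stdComplexGaussian P) (hind : iIndepFun X P) (hq : q.PosSemidef)
    (ht : 0 < q.trace.re) :
    ∫ ω, (quadForm q (fun i => X i ω) / q.trace.re - 1) ^ 4 ∂P ≤
      ∫ z, ‖z‖ ^ 8 ∂stdComplexGaussian + 1 := by
  have := hind.isProbabilityMeasure
  set u : Ω → ℝ := fun ω => quadForm q (fun i => X i ω) / q.trace.re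
  have hu0 ω : 0 ≤ u ω := div_nonneg (quadForm_nonneg hq _) ht.le
  have hu4 : Integrable (fun ω => u ω ^ 4) P :=
    integrable_pow_of_memLp (memLp_quadForm_div_trace hX hq (p := 4) (by simp)) (by simp)
  calc ∫ ω, (u ω - 1) ^ 4 ∂P ≤ ∫ ω, (u ω ^ 4 + 1) ∂P := by
        refine integral_mono_of_nonneg (ae_of_all _ fun ω => by positivity)
          (hu4.add (integrable_const 1)) (ae_of_all _ fun ω => ?_)
        have hgap : 0 ≤ 2 * u ω * (2 * (u ω - 3 / 4) ^ 2 + 7 / 8) :=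
          mul_nonneg (mul_nonneg zero_le_two (hu0 ω)) (by positivity)
        linear_combination hgap
    _ = ∫ ω, u ω ^ 4 ∂P + 1 := by simp [integral_add hu4 (integrable_const 1)]
    _ ≤ ∫ z, ‖z‖ ^ 8 ∂stdComplexGaussian + 1 := by
        gcongr
        exact integral_quadForm_div_trace_pow_le hX hind hq ht 4

lemma lintegral_gain_sub_one_pow_four_le [Nonempty κ] {X : κ × ι → Ω → ℂ}
    (hX : ∀ p, HasLaw (X p) stdComplexGaussian P) (hind : iIndepFun X P) (hq : q.PosSemidef)
    (ht : 0 < q.trace.re) :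
    ∫⁻ ω, .ofReal ((gain q (Matrix.of fun i j => X (i, j) ω) - 1) ^ 4) ∂P ≤
      .ofReal (3 * (∫ z, ‖z‖ ^ 8 ∂stdComplexGaussian + 1) / (Fintype.card κ : ℝ) ^ 2) := by
  have := hind.isProbabilityMeasure
  set Z : κ → Ω → ℝ := fun i ω => quadForm q (fun j => X (i, j) ω) / q.trace.re - 1
  have hrow i : iIndepFun (fun j => X (i, j)) P := hind.precomp (Prod.mk_right_injective i)
  have hquad i : MemLp (fun ω => quadForm q (fun j => X (i, j) ω) / q.trace.re) 4 P :=
    memLp_quadForm_div_trace (fun j => hX (i, j)) hq (by simp)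
  have hZ i : MemLp (Z i) 4 P := (hquad i).sub (memLp_const 1)
  have hZind : iIndepFun Z P :=
    (iIndepFun_curry (fun p => (hX p).aemeasurable) hind).comp
      (fun _ z => quadForm q z / q.trace.re - 1) fun _ => by
        have := measurable_quadForm.comp (measurable_prodMk_left (x := (q : ι → ι → ℂ)))
        exact (this.div_const _).sub_const 1
  have hZ0 i : ∫ ω, Z i ω ∂P = 0 := by
    rw [integral_sub ((hquad i).integrable (by simp)) (integrable_const _), integral_div,
      integral_quadForm (fun j => hX (i, j)) (hrow i) hq, div_self ht.ne']
    simp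
  have hZ4 i : ∫ ω, Z i ω ^ 4 ∂P ≤ ∫ z, ‖z‖ ^ 8 ∂stdComplexGaussian + 1 :=
    integral_quadForm_div_trace_sub_one_pow_four_le (fun j => hX (i, j)) (hrow i) hq ht
  have hsum_int : Integrable (fun ω => (∑ i, Z i ω) ^ 4) P :=
    integrable_pow_of_memLp (memLp_finsetSum _ fun i _ => hZ i) (by simp)
  have : (0 : ℝ) < Fintype.card κ := Nat.cast_pos.2 Fintype.card_pos
  calc _ = ∫⁻ ω, .ofReal ((∑ i, Z i ω) ^ 4 / (Fintype.card κ : ℝ) ^ 4) ∂P := by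
        simp_rw [gain_sub_one, div_pow]
        rfl
    _ = .ofReal ((∫ ω, (∑ i, Z i ω) ^ 4 ∂P) / (Fintype.card κ : ℝ) ^ 4) := by
        rw [← integral_div, ofReal_integral_eq_lintegral_ofReal (hsum_int.div_const _)
          (ae_of_all _ fun ω => by positivity)]
    _ ≤ _ := by
        refine ENNReal.ofReal_le_ofReal ?_
        rw [div_le_div_iff₀ (by positivity) (by positivity), show 4 = 2 + 2 from rfl, pow_add,
          ← mul_assoc]
        gcongr
        exact integral_sum_pow_four_le hZ hZind hZ0 hZ4 Finset.univ

end Gain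

section SecondOrder

open scoped Matrix

variable {Ω : Type*} [MeasurableSpace Ω] {P : Measure Ω}

/-- The matrix `E[y zᴴ]` of two random vectors. -/
def crossMoment {ι κ : Type*} (P : Measure Ω) (y : Ω → ι → ℂ) (z : Ω → κ → ℂ) : Matrix ι κ ℂ :=
  Matrix.of fun i j => ∫ ω, y ω i * star (z ω j) ∂P

lemma crossMoment_self {n : ℕ} (y : Ω → Fin n → ℂ) : crossMoment P y y = secondMoment P y := rfl

variable {ι κ l : Type*}

lemma conjTranspose_crossMoment (y : Ω → ι → ℂ) (z : Ω → κ → ℂ) :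
    (crossMoment P y z)ᴴ = crossMoment P z y := by
  ext j i
  simp [crossMoment, ← integral_conj, mul_comm]

lemma memLp_mulVec_add [Fintype ι] {y : Ω → ι → ℂ} {v : Ω → κ → ℂ} {p : ℝ≥0∞} (G : Matrix κ ι ℂ)
    (hy : ∀ a, MemLp (fun ω => y ω a) p P) (hv : ∀ i, MemLp (fun ω => v ω i) p P) (i : κ) :
    MemLp (fun ω => (G *ᵥ y ω + v ω) i) p P :=
  (memLp_finsetSum _ fun a _ => (hy a).const_mul (G i a)).add (hv i)

lemma crossMoment_mulVec_add [Fintype ι] {y : Ω → ι → ℂ} {v : Ω → κ → ℂ} {z : Ω → l → ℂ}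
    (G : Matrix κ ι ℂ) (hy : ∀ a, MemLp (fun ω => y ω a) 2 P)
    (hv : ∀ i, MemLp (fun ω => v ω i) 2 P) (hz : ∀ j, MemLp (fun ω => z ω j) 2 P) :
    crossMoment P (fun ω => G *ᵥ y ω + v ω) z = G * crossMoment P y z + crossMoment P v z := by
  ext i j
  have hyz a : Integrable (fun ω => G i a * (y ω a * star (z ω j))) P :=
    ((hy a).integrable_mul (hz j).star).const_mul _
  have hvz : Integrable (fun ω => v ω i * star (z ω j)) P := (hv i).integrable_mul (hz j).star
  calc ∫ ω, (G *ᵥ y ω + v ω) i * star (z ω j) ∂P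
      = ∫ ω, (∑ a, G i a * (y ω a * star (z ω j)) + v ω i * star (z ω j)) ∂P := by
        simp only [Pi.add_apply, Matrix.mulVec, dotProduct, add_mul, Finset.sum_mul, mul_assoc]
    _ = ∑ a, G i a * ∫ ω, y ω a * star (z ω j) ∂P + ∫ ω, v ω i * star (z ω j) ∂P := by
        rw [integral_add (integrable_finsetSum _ fun a _ => hyz a) hvz,
          integral_finsetSum _ fun a _ => hyz a]
        simp only [integral_const_mul]

lemma secondMoment_mulVec_add {m n : ℕ} {y : Ω → Fin n → ℂ} {v : Ω → Fin m → ℂ}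
    (G : Matrix (Fin m) (Fin n) ℂ) (hy : ∀ a, MemLp (fun ω => y ω a) 2 P)
    (hv : ∀ i, MemLp (fun ω => v ω i) 2 P) (hyv : crossMoment P y v = 0) :
    secondMoment P (fun ω => G *ᵥ y ω + v ω) = G * secondMoment P y * Gᴴ + secondMoment P v := by
  have hvy : crossMoment P v y = 0 := by
    rw [← conjTranspose_crossMoment, hyv, Matrix.conjTranspose_zero]
  have hyG : crossMoment P y (fun ω => G *ᵥ y ω + v ω) = secondMoment P y * Gᴴ := by
    rw [← conjTranspose_crossMoment, crossMoment_mulVec_add G hy hv hy, hvy, add_zero,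
      Matrix.conjTranspose_mul, conjTranspose_crossMoment, crossMoment_self]
  have hvG : crossMoment P v (fun ω => G *ᵥ y ω + v ω) = secondMoment P v := by
    rw [← conjTranspose_crossMoment, crossMoment_mulVec_add G hy hv hv, hyv, Matrix.mul_zero,
      zero_add, conjTranspose_crossMoment, crossMoment_self]
  rw [← crossMoment_self, crossMoment_mulVec_add G hy hv (memLp_mulVec_add G hy hv), hyG, hvG,
    Matrix.mul_assoc]

lemma integral_mul_star_of_indepFun {X Y : Ω → ℂ} (hX : HasLaw X stdComplexGaussian P)
    (hY : HasLaw Y stdComplexGaussian P) (hXY : IndepFun X Y P) :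
    ∫ ω, X ω * star (Y ω) ∂P = 0 := by
  have hstar : Measurable (star : ℂ → ℂ) := continuous_star.measurable
  have h := (hXY.comp measurable_id hstar).integral_fun_mul_eq_mul_integral
    hX.aemeasurable.aestronglyMeasurable
    (hstar.comp_aemeasurable hY.aemeasurable).aestronglyMeasurable
  refine h.trans ?_
  simp [hX.integral_eq, integral_id_stdComplexGaussian]

lemma integral_mul_star_self {X : Ω → ℂ} (hX : HasLaw X stdComplexGaussian P) :
    ∫ ω, X ω * star (X ω) ∂P = 1 := by
  have h : ∫ ω, ‖X ω‖ ^ 2 ∂P = 1 :=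
    (hX.integral_comp (f := fun z => ‖z‖ ^ 2) (by fun_prop)).trans
      integral_norm_sq_stdComplexGaussian
  simp_rw [Complex.star_def, Complex.mul_conj', ← Complex.ofReal_pow]
  rw [integral_complex_ofReal, h, Complex.ofReal_one]

lemma crossMoment_eq_zero {y : Ω → ι → ℂ} {z : Ω → κ → ℂ}
    (hy : ∀ i, HasLaw (fun ω => y ω i) stdComplexGaussian P)
    (hz : ∀ j, HasLaw (fun ω => z ω j) stdComplexGaussian P)
    (hyz : ∀ i j, IndepFun (fun ω => y ω i) (fun ω => z ω j) P) : crossMoment P y z = 0 := by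
  ext i j
  exact integral_mul_star_of_indepFun (hy i) (hz j) (hyz i j)

lemma secondMoment_eq_one {m : ℕ} {v : Ω → Fin m → ℂ}
    (hv : ∀ i, HasLaw (fun ω => v ω i) stdComplexGaussian P)
    (hind : iIndepFun (fun i ω => v ω i) P) : secondMoment P v = 1 := by
  ext i j
  rcases eq_or_ne i j with rfl | hij
  · exact (integral_mul_star_self (hv i)).trans (Matrix.one_apply_eq i).symm
  · exact (integral_mul_star_of_indepFun (hv i) (hv j) (hind.indepFun hij)).trans
      (Matrix.one_apply_ne hij).symm

end SecondOrder

section Covariance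

open scoped ComplexOrder Matrix

/-- The covariance matrix of the vector that node `k` retransmits, for fixed channel matrices `h`,
by the recursion obtained from that of `node` when the second moments are computed. -/
def cov (α ρ : ℕ → ℝ) (d : ℕ → ℕ) (h : ∀ k, Matrix (Fin (d (k + 1))) (Fin (d k)) ℂ) :
    ∀ k, Matrix (Fin (d k)) (Fin (d k)) ℂ
  | 0 => 1
  | k + 1 => ((α (k + 1) * ρ k / (cov α ρ d h k).trace.re : ℝ) : ℂ) •
      (h k * cov α ρ d h k * (h k)ᴴ) + 1

lemma trace_re_nonneg {ι : Type*} [Fintype ι] {q : Matrix ι ι ℂ} (hq : q.PosSemidef) :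
    0 ≤ q.trace.re :=
  (Complex.le_def.1 hq.trace_nonneg).1

variable {α ρ : ℕ → ℝ} {d : ℕ → ℕ} {k : ℕ}

lemma posSemidef_cov (hαρ : ∀ j < k, 0 ≤ α (j + 1) * ρ j)
    (h : ∀ k, Matrix (Fin (d (k + 1))) (Fin (d k)) ℂ) : (cov α ρ d h k).PosSemidef := by
  induction k with
  | zero => exact .one
  | succ k ih =>
    have hq := ih fun j hj => hαρ j (hj.trans k.lt_succ_self)
    refine ((hq.mul_mul_conjTranspose_same (h k)).smul ?_).add .one
    exact Complex.zero_le_real.2 (div_nonneg (hαρ k k.lt_succ_self) (trace_re_nonneg hq))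

lemma trace_cov_succ (h : ∀ k, Matrix (Fin (d (k + 1))) (Fin (d k)) ℂ) (k : ℕ) :
    (cov α ρ d h (k + 1)).trace.re =
      d (k + 1) * (1 + α (k + 1) * ρ k * gain (cov α ρ d h k) (h k)) := by
  rcases eq_or_ne (d (k + 1) : ℝ) 0 with hd | hd
  · have : IsEmpty (Fin (d (k + 1))) := Fintype.card_eq_zero_iff.1 (by simpa using hd)
    simp [Matrix.trace, hd]
  · simp only [cov, gain, Matrix.trace_add, Matrix.trace_smul, Matrix.trace_one, Fintype.card_fin,
      Complex.add_re, smul_eq_mul, Complex.re_ofReal_mul, Complex.natCast_re]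
    field_simp
    ring

lemma gain_nonneg {ι κ : Type*} [Fintype ι] [Fintype κ] {q : Matrix ι ι ℂ} (hq : q.PosSemidef)
    (h : Matrix κ ι ℂ) : 0 ≤ gain q h :=
  div_nonneg (trace_re_nonneg (hq.mul_mul_conjTranspose_same h))
    (mul_nonneg (Nat.cast_nonneg _) (trace_re_nonneg hq))

lemma trace_cov_pos (hαρ : ∀ j < k, 0 ≤ α (j + 1) * ρ j)
    (h : ∀ k, Matrix (Fin (d (k + 1))) (Fin (d k)) ℂ) (hd : 0 < d k) :
    0 < (cov α ρ d h k).trace.re := by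
  cases k with
  | zero => simpa [cov] using hd
  | succ k =>
    have hq := posSemidef_cov (d := d) (fun j hj => hαρ j (hj.trans k.lt_succ_self)) h
    have := mul_nonneg (hαρ k k.lt_succ_self) (gain_nonneg hq (h k))
    rw [trace_cov_succ]
    positivity

end Covariance

section Node

open scoped Matrix

variable {Ω : Type*} [MeasurableSpace Ω] {P : Measure Ω}

lemma powerFactor_eq (r : ℝ) {m : ℕ} (y : Ω → Fin m → ℂ) :
    powerFactor P r y = m * (r / (secondMoment P y).trace.re) := by
  rw [powerFactor, one_div, div_mul_eq_div_div, div_inv_eq_mul, mul_comm, mul_div_assoc]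

lemma powerFactor_div (r : ℝ) {m : ℕ} (y : Ω → Fin m → ℂ) :
    powerFactor P r y / m = r / (secondMoment P y).trace.re := by
  rcases m.eq_zero_or_pos with rfl | hm
  · simp [Matrix.trace]
  · rw [powerFactor_eq, mul_div_cancel_left₀ _ (by positivity)]

variable {α ρ : ℕ → ℝ} {d : ℕ → ℕ}
  {x : Ω → Fin (d 0) → ℂ} {w : ∀ k, Ω → Fin (d (k + 1)) → ℂ}

lemma node_snd (h : ∀ k, Matrix (Fin (d (k + 1))) (Fin (d k)) ℂ) (k : ℕ) :
    (node P α ρ d h x w k).2 = powerFactor P (ρ k) (node P α ρ d h x w k).1 := by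
  cases k <;> rfl

lemma node_succ_fst (h : ∀ k, Matrix (Fin (d (k + 1))) (Fin (d k)) ℂ) (k : ℕ) :
    (node P α ρ d h x w (k + 1)).1 = fun ω =>
      (((√(α (k + 1)) * √((node P α ρ d h x w k).2 / d k) : ℝ) : ℂ) • h k) *ᵥ
        (node P α ρ d h x w k).1 ω + w k ω := by
  funext ω
  simp [node, Matrix.mulVec_smul, Matrix.smul_mulVec, smul_smul]

variable {K : ℕ} {H : ∀ k, Ω → Matrix (Fin (d (k + 1))) (Fin (d k)) ℂ}

lemma IsGaussianModel.hasLaw_source (hmodel : IsGaussianModel P K d H x w) (i : Fin (d 0)) :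
    HasLaw (fun ω => x ω i) stdComplexGaussian P :=
  hmodel.law (.inr (.inl i))

lemma IsGaussianModel.hasLaw_noise (hmodel : IsGaussianModel P K d H x w) {k : ℕ} (hk : k < K)
    (i : Fin (d (k + 1))) : HasLaw (fun ω => w k ω i) stdComplexGaussian P :=
  hmodel.law (.inr (.inr ⟨⟨k, hk⟩, i⟩))

lemma IsGaussianModel.secondMoment_source (hmodel : IsGaussianModel P K d H x w) :
    secondMoment P x = 1 :=
  secondMoment_eq_one hmodel.hasLaw_source
    (hmodel.indep.precomp (Sum.inr_injective.comp Sum.inl_injective))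

lemma IsGaussianModel.secondMoment_noise (hmodel : IsGaussianModel P K d H x w) {k : ℕ}
    (hk : k < K) : secondMoment P (w k) = 1 :=
  secondMoment_eq_one (hmodel.hasLaw_noise hk) <| hmodel.indep.precomp
    (g := fun i => .inr (.inr ⟨⟨k, hk⟩, i⟩)) fun i j hij => by simpa using hij

lemma IsGaussianModel.crossMoment_source_noise (hmodel : IsGaussianModel P K d H x w) {l : ℕ}
    (hl : l < K) : crossMoment P x (w l) = 0 :=
  crossMoment_eq_zero hmodel.hasLaw_source (hmodel.hasLaw_noise hl) fun i j =>
    hmodel.indep.indepFun (i := .inr (.inl i)) (j := .inr (.inr ⟨⟨l, hl⟩, j⟩)) (by simp)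

lemma IsGaussianModel.crossMoment_noise_noise (hmodel : IsGaussianModel P K d H x w) {k l : ℕ}
    (hkl : k < l) (hl : l < K) : crossMoment P (w k) (w l) = 0 :=
  crossMoment_eq_zero (hmodel.hasLaw_noise (hkl.trans hl)) (hmodel.hasLaw_noise hl) fun i j =>
    hmodel.indep.indepFun (i := .inr (.inr ⟨⟨k, hkl.trans hl⟩, i⟩))
      (j := .inr (.inr ⟨⟨l, hl⟩, j⟩)) (by simp [hkl.ne])

lemma memLp_node (hmodel : IsGaussianModel P K d H x w)
    (h : ∀ k, Matrix (Fin (d (k + 1))) (Fin (d k)) ℂ) {k : ℕ} (hk : k ≤ K) {p : ℝ≥0∞} (hp : p ≠ ∞)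
    (i : Fin (d k)) : MemLp (fun ω => (node P α ρ d h x w k).1 ω i) p P := by
  induction k with
  | zero => exact memLp_of_hasLaw (hmodel.hasLaw_source i) hp
  | succ k ih =>
    rw [node_succ_fst]
    exact memLp_mulVec_add _ (ih (Nat.le_of_succ_le hk))
      (fun i => memLp_of_hasLaw (hmodel.hasLaw_noise hk i) hp) i

lemma crossMoment_node_noise (hmodel : IsGaussianModel P K d H x w)
    (h : ∀ k, Matrix (Fin (d (k + 1))) (Fin (d k)) ℂ) {k l : ℕ} (hkl : k ≤ l) (hl : l < K) :
    crossMoment P (node P α ρ d h x w k).1 (w l) = 0 := by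
  have hw {m} (hm : m < K) i : MemLp (fun ω => w m ω i) 2 P :=
    memLp_of_hasLaw (hmodel.hasLaw_noise hm i) (by simp)
  induction k with
  | zero => exact hmodel.crossMoment_source_noise hl
  | succ k ih =>
    rw [node_succ_fst, crossMoment_mulVec_add _
      (memLp_node hmodel h (hkl.trans hl.le |> Nat.le_of_succ_le) (by simp))
      (hw (hkl.trans_lt hl |> Nat.lt_of_succ_lt)) (hw hl), ih (Nat.le_of_succ_le hkl),
      hmodel.crossMoment_noise_noise hkl hl, Matrix.mul_zero, add_zero]

lemma secondMoment_node (hmodel : IsGaussianModel P K d H x w)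
    (h : ∀ k, Matrix (Fin (d (k + 1))) (Fin (d k)) ℂ) {k : ℕ} (hk : k ≤ K)
    (hα : ∀ j < k, 0 ≤ α (j + 1)) (hρ : ∀ j < k, 0 ≤ ρ j) :
    secondMoment P (node P α ρ d h x w k).1 = cov α ρ d h k := by
  induction k with
  | zero => exact hmodel.secondMoment_source
  | succ k ih =>
    have hα' j (hj : j < k) := hα j (hj.trans k.lt_succ_self)
    have hρ' j (hj : j < k) := hρ j (hj.trans k.lt_succ_self)
    have ih := ih (Nat.le_of_succ_le hk) hα' hρ'
    have hw i : MemLp (fun ω => w k ω i) 2 P :=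
      memLp_of_hasLaw (hmodel.hasLaw_noise hk i) (by simp)
    have hq := posSemidef_cov (d := d) (fun j hj => mul_nonneg (hα' j hj) (hρ' j hj)) h
    have hamp : (√(α (k + 1)) * √((node P α ρ d h x w k).2 / d k)) ^ 2 =
        α (k + 1) * ρ k / (cov α ρ d h k).trace.re := by
      rw [node_snd, powerFactor_div, ih, mul_pow, Real.sq_sqrt (hα k k.lt_succ_self),
        Real.sq_sqrt (div_nonneg (hρ k k.lt_succ_self) (trace_re_nonneg hq)), mul_div_assoc]
    rw [node_succ_fst, secondMoment_mulVec_add _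
      (memLp_node hmodel h (Nat.le_of_succ_le hk) (by simp)) hw
      (crossMoment_node_noise hmodel h le_rfl hk), ih, hmodel.secondMoment_noise hk, cov, ← hamp]
    simp [smul_smul, sq]

lemma node_succ_snd (hmodel : IsGaussianModel P K d H x w)
    (h : ∀ k, Matrix (Fin (d (k + 1))) (Fin (d k)) ℂ) {k : ℕ} (hk : k < K)
    (hα : ∀ j ≤ k, 0 ≤ α (j + 1)) (hρ : ∀ j ≤ k, 0 ≤ ρ j) (hd : d (k + 1) ≠ 0) :
    (node P α ρ d h x w (k + 1)).2 =
      ρ (k + 1) / (1 + α (k + 1) * ρ k * gain (cov α ρ d h k) (h k)) := by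
  rw [node_snd, powerFactor_eq, secondMoment_node hmodel h hk (fun j hj => hα j (by omega))
    (fun j hj => hρ j (by omega)), trace_cov_succ, ← mul_div_assoc,
    mul_div_mul_left _ _ (Nat.cast_ne_zero.2 hd)]

end Node

section Channel

variable {α ρ : ℕ → ℝ} {d : ℕ → ℕ} {k : ℕ}

lemma cov_congr {h h' : ∀ k, Matrix (Fin (d (k + 1))) (Fin (d k)) ℂ}
    (hh : ∀ j < k, h j = h' j) : cov α ρ d h k = cov α ρ d h' k := by
  induction k with
  | zero => rfl
  | succ k ih =>
    rw [cov, cov, hh k k.lt_succ_self, ih fun j hj => hh j (hj.trans k.lt_succ_self)]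

lemma measurable_cov (i j : Fin (d k)) :
    Measurable fun h : ∀ k, Fin (d (k + 1)) → Fin (d k) → ℂ =>
      cov α ρ d (fun j => Matrix.of (h j)) k i j := by
  have hstar : Measurable (star : ℂ → ℂ) := continuous_star.measurable
  induction k with
  | zero => exact measurable_const
  | succ k ih =>
    simp only [cov, Matrix.add_apply, Matrix.smul_apply, Matrix.mul_apply, Matrix.trace,
      Matrix.diag_apply, Matrix.conjTranspose_apply, Matrix.of_apply, smul_eq_mul]
    fun_prop

lemma exists_measurable_cov_eq (α ρ : ℕ → ℝ) (d : ℕ → ℕ) (k : ℕ) :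
    ∃ F : ((Σ j : Fin k, Fin (d (j + 1)) × Fin (d j)) → ℂ) → Fin (d k) → Fin (d k) → ℂ,
      Measurable F ∧ ∀ h, (F fun p => h p.1 p.2.1 p.2.2) = fun i j => cov α ρ d h k i j := by
  let G : ((Σ j : Fin k, Fin (d (j + 1)) × Fin (d j)) → ℂ) →
      ∀ j, Fin (d (j + 1)) → Fin (d j) → ℂ :=
    fun u j a b => if hj : j < k then u ⟨⟨j, hj⟩, a, b⟩ else 0
  have hG : Measurable G := by
    refine measurable_pi_lambda _ fun j => ?_
    by_cases hj : j < k <;> simp only [G, hj, dite_true, dite_false] <;> fun_prop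
  refine ⟨fun u i j => cov α ρ d (fun l => Matrix.of (G u l)) k i j, ?_, fun h => ?_⟩
  · exact measurable_pi_lambda _ fun i => measurable_pi_lambda _ fun j =>
      (measurable_cov i j).comp hG
  · have hcov : cov α ρ d (fun l => Matrix.of (G (fun p => h p.1 p.2.1 p.2.2) l)) k =
        cov α ρ d h k := cov_congr fun j hj => by
      ext a b
      simp [G, hj]
    simp only [hcov]

variable {Ω : Type*} [MeasurableSpace Ω] {P : Measure Ω} {K : ℕ}
  {H : ∀ k, Ω → Matrix (Fin (d (k + 1))) (Fin (d k)) ℂ}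
  {x : Ω → Fin (d 0) → ℂ} {w : ∀ k, Ω → Fin (d (k + 1)) → ℂ}

lemma IsGaussianModel.hasLaw_channel (hmodel : IsGaussianModel P K d H x w) (hk : k < K)
    (p : Fin (d (k + 1)) × Fin (d k)) : HasLaw (fun ω => H k ω p.1 p.2) stdComplexGaussian P :=
  hmodel.law (.inl ⟨⟨k, hk⟩, p⟩)

lemma IsGaussianModel.iIndepFun_channel (hmodel : IsGaussianModel P K d H x w) (hk : k < K) :
    iIndepFun (fun (p : Fin (d (k + 1)) × Fin (d k)) ω => H k ω p.1 p.2) P :=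
  hmodel.indep.precomp (g := fun p => .inl ⟨⟨k, hk⟩, p⟩) fun p q hpq => by simpa using hpq

lemma IsGaussianModel.indepFun_previous_channels (hmodel : IsGaussianModel P K d H x w)
    (hk : k < K) :
    IndepFun (fun ω (p : Σ j : Fin k, Fin (d (j + 1)) × Fin (d j)) => H p.1 ω p.2.1 p.2.2)
      (fun ω (p : Fin (d (k + 1)) × Fin (d k)) => H k ω p.1 p.2) P := by
  refine indepFun_precomp_of_disjoint_range (fun e => (hmodel.law e).aemeasurable) hmodel.indep
    (f := fun p : Σ j : Fin k, Fin (d (j + 1)) × Fin (d j) =>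
      .inl ⟨⟨p.1, p.1.2.trans hk⟩, p.2⟩) (g := fun p => .inl ⟨⟨k, hk⟩, p⟩) ?_
  rw [Set.disjoint_left]
  rintro _ ⟨p, rfl⟩ ⟨q, hq⟩
  have := congrArg (Fin.val ∘ Sigma.fst) (Sum.inl.inj hq)
  exact p.1.2.ne' this

lemma IsGaussianModel.aemeasurable_cov (hmodel : IsGaussianModel P K d H x w) (hk : k ≤ K) :
    AEMeasurable (fun ω i j => cov α ρ d (fun l => H l ω) k i j) P := by
  obtain ⟨F, hF, hFcov⟩ := exists_measurable_cov_eq α ρ d k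
  simp only [← hFcov]
  exact hF.comp_aemeasurable <| aemeasurable_pi_lambda _ fun p =>
    (hmodel.hasLaw_channel (p.1.2.trans_le hk) p.2).aemeasurable

lemma IsGaussianModel.indepFun_cov_channel (hmodel : IsGaussianModel P K d H x w) (hk : k < K) :
    IndepFun (fun ω i j => cov α ρ d (fun l => H l ω) k i j) (fun ω i j => H k ω i j) P := by
  obtain ⟨F, hF, hFcov⟩ := exists_measurable_cov_eq α ρ d k
  simp only [← hFcov]
  exact (hmodel.indepFun_previous_channels hk).comp hF (ψ := fun u i j => u (i, j)) (by fun_prop)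

lemma IsGaussianModel.aemeasurable_channel (hmodel : IsGaussianModel P K d H x w) (hk : k < K) :
    AEMeasurable (fun ω i j => H k ω i j) P :=
  aemeasurable_pi_lambda _ fun i => aemeasurable_pi_lambda _ fun j =>
    (hmodel.hasLaw_channel hk (i, j)).aemeasurable

lemma aemeasurable_gain_cov (hmodel : IsGaussianModel P K d H x w) (hk : k < K) :
    AEMeasurable (fun ω => gain (cov α ρ d (fun j => H j ω) k) (H k ω)) P := by
  have hcov := hmodel.aemeasurable_cov (α := α) (ρ := ρ) hk.le
  have h := measurable_gain.comp_aemeasurable (hcov.prodMk (hmodel.aemeasurable_channel hk))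
  exact h

lemma lintegral_gain_cov_sub_one_pow_four_le (hmodel : IsGaussianModel P K d H x w) (hk : k < K)
    (hαρ : ∀ j < k, 0 ≤ α (j + 1) * ρ j) (hd : 0 < d k) (hd' : 0 < d (k + 1)) :
    ∫⁻ ω, .ofReal ((gain (cov α ρ d (fun j => H j ω) k) (H k ω) - 1) ^ 4) ∂P ≤
      .ofReal (3 * (∫ z, ‖z‖ ^ 8 ∂stdComplexGaussian + 1) / (d (k + 1) : ℝ) ^ 2) := by
  have := hmodel.indep.isProbabilityMeasure
  have : Nonempty (Fin (d (k + 1))) := Fin.pos_iff_nonempty.1 hd'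
  have hfixed ω := lintegral_gain_sub_one_pow_four_le (hmodel.hasLaw_channel hk)
    (hmodel.iIndepFun_channel hk) (posSemidef_cov hαρ fun j => H j ω)
    (trace_cov_pos hαρ (fun j => H j ω) hd)
  simp only [Fintype.card_fin] at hfixed
  exact lintegral_le_of_indepFun (hmodel.aemeasurable_cov hk.le) (hmodel.aemeasurable_channel hk)
    (hmodel.indepFun_cov_channel hk)
    (f := fun a b => .ofReal ((gain (Matrix.of a) (Matrix.of b) - 1) ^ 4))
    ((measurable_gain.sub_const 1).pow_const 4).ennreal_ofReal hfixed

end Channel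

section Convergence

open Asymptotics

variable {Ω : Type*} [MeasurableSpace Ω] {P : Measure Ω}

lemma ae_tendsto_zero_of_tsum_lintegral_ne_top {f : ℕ → Ω → ℝ≥0∞} (hf : ∀ n, AEMeasurable (f n) P)
    (h : ∑' n, ∫⁻ ω, f n ω ∂P ≠ ∞) : ∀ᵐ ω ∂P, Tendsto (fun n => f n ω) atTop (𝓝 0) := by
  rw [← lintegral_tsum hf] at h
  filter_upwards [ae_lt_top' (AEMeasurable.tsum hf) h] with ω hω
  exact ENNReal.tendsto_atTop_zero_of_tsum_ne_top hω.ne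

lemma tendsto_of_tendsto_ofReal_pow_four {ι : Type*} {l : Filter ι} {r : ι → ℝ} {a : ℝ}
    (h : Tendsto (fun n => ENNReal.ofReal ((r n - a) ^ 4)) l (𝓝 0)) : Tendsto r l (𝓝 a) := by
  have hpow : Tendsto (fun n => (r n - a) ^ 4) l (𝓝 0) := by
    simpa [Function.comp_def, Even.pow_nonneg (n := 4) (by decide)] using
      (ENNReal.tendsto_toReal ENNReal.zero_ne_top).comp h
  have habs : Tendsto (fun n => |r n - a|) l (𝓝 0) := by
    refine (Real.sqrt_zero ▸ Real.sqrt_zero ▸ hpow.sqrt.sqrt).congr fun n => ?_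
    rw [show 4 = 2 * 2 from rfl, pow_mul, Real.sqrt_sq (sq_nonneg _), Real.sqrt_sq_eq_abs]
  exact tendsto_sub_nhds_zero_iff.1 ((tendsto_zero_iff_abs_tendsto_zero _).2 habs)

lemma ae_tendsto_of_lintegral_pow_four_le {R : ℕ → Ω → ℝ} {a : ℝ} {u : ℕ → ℝ} (hu : Summable u)
    (hm : ∀ n, AEMeasurable (R n) P)
    (hR : ∀ᶠ n in atTop, ∫⁻ ω, .ofReal ((R n ω - a) ^ 4) ∂P ≤ .ofReal (u n)) :
    ∀ᵐ ω ∂P, Tendsto (fun n => R n ω) atTop (𝓝 a) := by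
  obtain ⟨N, hN⟩ := eventually_atTop.1 hR
  have hsum : ∑' n, ∫⁻ ω, .ofReal ((R (n + N) ω - a) ^ 4) ∂P ≠ ∞ :=
    ne_top_of_le_ne_top ((summable_nat_add_iff N).2 hu).tsum_ofReal_ne_top
      (ENNReal.tsum_le_tsum fun n => hN (n + N) (Nat.le_add_left N n))
  filter_upwards [ae_tendsto_zero_of_tsum_lintegral_ne_top
    (fun n => (((hm (n + N)).sub_const a).pow_const 4).ennreal_ofReal) hsum] with ω hω
  exact (tendsto_add_atTop_iff_nat N).1 (tendsto_of_tendsto_ofReal_pow_four hω)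

lemma isBigO_of_limsup_div_lt_top {ι : Type*} {l : Filter ι} {a b : ι → ℕ}
    (h : limsup (fun n => (a n : ℝ≥0∞) / (b n : ℝ≥0∞)) l < ⊤) :
    (fun n => (a n : ℝ)) =O[l] fun n => (b n : ℝ) := by
  obtain ⟨M, hM, -⟩ := ENNReal.lt_iff_exists_nnreal_btwn.1 h
  refine IsBigO.of_bound M ?_
  filter_upwards [eventually_lt_of_limsup_lt hM] with n hn
  have := (ENNReal.div_le_iff_le_mul (.inr ENNReal.coe_ne_top) (.inl (by simp))).1 hn.le
  simp only [Real.norm_natCast]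
  exact_mod_cast this

lemma isBigO_dim {d : ℕ → ℕ → ℕ} {k : ℕ} (hd : ∀ n, d n 0 = n)
    (hc : ∀ j < k, limsup (fun n => (d n j : ℝ≥0∞) / (d n (j + 1) : ℝ≥0∞)) atTop < ⊤) :
    (fun n : ℕ => (n : ℝ)) =O[atTop] fun n => (d n k : ℝ) := by
  induction k with
  | zero => simpa only [hd] using isBigO_refl _ _
  | succ k ih =>
    exact (ih fun j hj => hc j (hj.trans k.lt_succ_self)).trans
      (isBigO_of_limsup_div_lt_top (hc k k.lt_succ_self))

lemma eventually_pos_of_isBigO {m : ℕ → ℕ}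
    (hm : (fun n : ℕ => (n : ℝ)) =O[atTop] fun n => (m n : ℝ)) : ∀ᶠ n in atTop, 0 < m n := by
  filter_upwards [hm.eq_zero_imp, eventually_gt_atTop 0] with n h hn
  refine Nat.pos_of_ne_zero fun h0 => hn.ne' ?_
  exact_mod_cast h (by exact_mod_cast h0)

lemma summable_inv_sq_of_isBigO {m : ℕ → ℕ}
    (hm : (fun n : ℕ => (n : ℝ)) =O[atTop] fun n => (m n : ℝ)) :
    Summable fun n => ((m n : ℝ) ^ 2)⁻¹ := by
  refine summable_of_isBigO_nat (Real.summable_nat_pow_inv.2 one_lt_two)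
    ((hm.pow 2).inv_rev ?_)
  filter_upwards [eventually_gt_atTop 0] with n hn h0
  exact absurd h0 (by positivity)

lemma ae_tendsto_gain_cov {K k : ℕ} {α ρ : ℕ → ℝ} {d : ℕ → ℕ → ℕ}
    {H : ∀ n k, Ω → Matrix (Fin (d n (k + 1))) (Fin (d n k)) ℂ}
    {x : ∀ n, Ω → Fin (d n 0) → ℂ} {w : ∀ n k, Ω → Fin (d n (k + 1)) → ℂ}
    (hmodel : ∀ n, IsGaussianModel P K (d n) (H n) (x n) (w n)) (hk : k < K)
    (hαρ : ∀ j < k, 0 ≤ α (j + 1) * ρ j)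
    (hd : ∀ᶠ n in atTop, 0 < d n k)
    (hd' : (fun n : ℕ => (n : ℝ)) =O[atTop] fun n => (d n (k + 1) : ℝ)) :
    ∀ᵐ ω ∂P, Tendsto (fun n => gain (cov α ρ (d n) (fun j => H n j ω) k) (H n k ω)) atTop
      (𝓝 1) := by
  have hsum := (summable_inv_sq_of_isBigO hd').mul_left
    (3 * (∫ z, ‖z‖ ^ 8 ∂stdComplexGaussian + 1))
  refine ae_tendsto_of_lintegral_pow_four_le hsum (fun n => aemeasurable_gain_cov (hmodel n) hk) ?_
  filter_upwards [hd, eventually_pos_of_isBigO hd'] with n h h'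
  exact lintegral_gain_cov_sub_one_pow_four_le (hmodel n) hk hαρ h h'

end Convergence

section Limit

variable {Ω : Type*} [MeasurableSpace Ω] {P : Measure Ω} {K : ℕ} {α ρ : ℕ → ℝ}

lemma beta_zero {d : ℕ → ℕ} {H : ∀ k, Ω → Matrix (Fin (d (k + 1))) (Fin (d k)) ℂ}
    {x : Ω → Fin (d 0) → ℂ} {w : ∀ k, Ω → Fin (d (k + 1)) → ℂ}
    (hmodel : IsGaussianModel P K d H x w) (hd : d 0 ≠ 0) (ω : Ω) :
    beta P α ρ d H x w 0 ω = ρ 0 := by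
  have : (d 0 : ℝ) ≠ 0 := Nat.cast_ne_zero.2 hd
  rw [beta, node_snd, powerFactor_eq]
  simp only [node, hmodel.secondMoment_source, Matrix.trace_one, Fintype.card_fin,
    Complex.natCast_re]
  exact mul_div_cancel₀ _ this

lemma ae_tendsto_beta_succ {k : ℕ} {d : ℕ → ℕ → ℕ}
    {H : ∀ n k, Ω → Matrix (Fin (d n (k + 1))) (Fin (d n k)) ℂ}
    {x : ∀ n, Ω → Fin (d n 0) → ℂ} {w : ∀ n k, Ω → Fin (d n (k + 1)) → ℂ}
    (hmodel : ∀ n, IsGaussianModel P K (d n) (H n) (x n) (w n)) (hk : k < K)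
    (hα : ∀ j ≤ k, 0 ≤ α (j + 1)) (hρ : ∀ j ≤ k, 0 ≤ ρ j) (hd : ∀ n, d n 0 = n)
    (hc : ∀ j ≤ k, limsup (fun n => (d n j : ℝ≥0∞) / (d n (j + 1) : ℝ≥0∞)) atTop < ⊤) :
    ∀ᵐ ω ∂P, Tendsto (fun n => beta P α ρ (d n) (H n) (x n) (w n) (k + 1) ω) atTop
      (𝓝 (ρ (k + 1) / (1 + α (k + 1) * ρ k))) := by
  have hdim := isBigO_dim (k := k) hd fun j hj => hc j hj.le
  have hdim' := isBigO_dim (k := k + 1) hd fun j hj => hc j (Nat.lt_succ_iff.1 hj)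
  have hαρ j (hj : j ≤ k) : 0 ≤ α (j + 1) * ρ j := mul_nonneg (hα j hj) (hρ j hj)
  have hden : 1 + α (k + 1) * ρ k * 1 ≠ 0 := by
    have := hαρ k le_rfl
    positivity
  filter_upwards [ae_tendsto_gain_cov hmodel hk (fun j hj => hαρ j hj.le)
    (eventually_pos_of_isBigO hdim) hdim'] with ω hgain
  have hlim := tendsto_const_nhds (x := ρ (k + 1)).div
    ((hgain.const_mul (α (k + 1) * ρ k)).const_add 1) hden
  rw [mul_one] at hlim
  refine hlim.congr' ?_
  filter_upwards [eventually_pos_of_isBigO hdim'] with n hn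
  exact (node_succ_snd (hmodel n) (fun j => H n j ω) hk hα hρ hn.ne').symm

end Limit

end Relay

end

theorem lemma1_general {Ω : Type*} [MeasurableSpace Ω] (P : Measure Ω) (K : ℕ) (α ρ : ℕ → ℝ)
    (hα : ∀ k, 1 ≤ k → k < K → 0 ≤ α k) (hρ : ∀ k, k < K → 0 ≤ ρ k)
    (d : ℕ → ℕ → ℕ) (hd : ∀ n, d n 0 = n)
    (hc : ∀ k, 1 ≤ k → k < K →
      limsup (fun n => (d n (k - 1) : ℝ≥0∞) / (d n k : ℝ≥0∞)) atTop < ⊤)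
    (H : ∀ n k, Ω → Matrix (Fin (d n (k + 1))) (Fin (d n k)) ℂ)
    (x : ∀ n, Ω → Fin (d n 0) → ℂ) (w : ∀ n k, Ω → Fin (d n (k + 1)) → ℂ)
    (hmodel : ∀ n, Relay.IsGaussianModel P K (d n) (H n) (x n) (w n)) :
    (∀ n, 1 ≤ n → ∀ ω, Relay.beta P α ρ (d n) (H n) (x n) (w n) 0 ω = ρ 0) ∧
    ∀ k, 1 ≤ k → k < K → ∀ᵐ ω ∂P,
      Tendsto (fun n => Relay.beta P α ρ (d n) (H n) (x n) (w n) k ω) atTop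
        (𝓝 (ρ k / (1 + α k * ρ (k - 1)))) := by
  refine ⟨fun n hn ω => Relay.beta_zero (hmodel n) (by rw [hd]; omega) ω, fun k hk hkK => ?_⟩
  obtain ⟨k, rfl⟩ := Nat.exists_eq_add_of_le' hk
  have hK j (hj : j ≤ k) : j + 1 < K := (Nat.succ_le_succ hj).trans_lt hkK
  exact Relay.ae_tendsto_beta_succ hmodel (Nat.lt_of_succ_lt hkK)
    (fun j hj => hα (j + 1) j.succ_pos (hK j hj)) (fun j hj => hρ j (Nat.lt_of_succ_lt (hK j hj)))
    hd fun j hj => hc (j + 1) j.succ_pos (hK j hj)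

theorem lemma1 {Ω : Type*} [MeasurableSpace Ω] (P : Measure Ω) [IsProbabilityMeasure P]
    (K : ℕ) (α ρ : ℕ → ℝ)
    (hα : ∀ k, 1 ≤ k → k ≤ K → 0 ≤ α k) (hρ : ∀ k, k < K → 0 < ρ k)
    -- `d n k` is the number of antennas of node `k` when the source has `n` antennas
    (d : ℕ → ℕ → ℕ) (hd : ∀ n, d n 0 = n)
    (hc : ∀ k, 1 ≤ k → k ≤ K →
      0 < liminf (fun n => (d n (k - 1) : ℝ≥0∞) / (d n k : ℝ≥0∞)) atTop ∧
      limsup (fun n => (d n (k - 1) : ℝ≥0∞) / (d n k : ℝ≥0∞)) atTop < ⊤)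
    (H : ∀ n k, Ω → Matrix (Fin (d n (k + 1))) (Fin (d n k)) ℂ)
    (x : ∀ n, Ω → Fin (d n 0) → ℂ) (w : ∀ n k, Ω → Fin (d n (k + 1)) → ℂ)
    -- for each `n`; nothing is assumed on the joint law for different `n`
    (hmodel : ∀ n, Relay.IsGaussianModel P K (d n) (H n) (x n) (w n)) :
    (∀ n, 1 ≤ n → ∀ ω, Relay.beta P α ρ (d n) (H n) (x n) (w n) 0 ω = ρ 0) ∧
    ∀ k, 1 ≤ k → k < K → ∀ᵐ ω ∂P,
      Tendsto (fun n => Relay.beta P α ρ (d n) (H n) (x n) (w n) k ω) atTop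
        (𝓝 (ρ k / (1 + α k * ρ (k - 1)))) :=
  lemma1_general P K α ρ (fun k h1 hk => hα k h1 hk.le) (fun k hk => (hρ k hk).le) d hd
    (fun k h1 hk => (hc k h1 hk.le).2) H x w hmodel
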